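/- Let $0<q<1$ and let $(e_n)_{n\in\mathbb{Z}}$ be the standard basis of the complex Hilbert space $\ell^2(\mathbb{Z})$. Let $A$ be the operator with domain $\operatorname{span}\{e_n\mid n\in\mathbb{Z}\}$ given by $Ae_n=q^{-n+1}e_{n-1}+q^{-n}e_{n+1}$, $n\in\mathbb{Z}$. Let $A_{\max}$ be the operator with domain $D$ consisting of all $\psi\in\ell^2(\mathbb{Z})$ for which the sequence $(q^{-n+1}\psi_{n-1}+q^{-n}\psi_{n+1})_{n\in\mathbb{Z}}$ belongs to $\ell^2(\mathbb{Z})$, and $A_{\max}\psi$ is this sequence. For $t\in\mathbb{R}\cup\{\infty\}$ let $A_t$ be the restriction of $A_{\max}$ to \[ \operatorname{Dom}A_t=\Big\{\psi\in D \;\Big|\; \lim_{n\to\infty}q^{-n}(\psi_{2n+1}+t\psi_{2n})=0\ \text{ and }\ \lim_{n\to\infty}q^{-n}(q\psi_{2n-1}-t\psi_{2n})=0\Big\}\quad\text{if } t\in\mathbb{R}, \] \[ \operatorname{Dom}A_\infty=\Big\{\psi\in D \;\Big|\; \lim_{n\to\infty}q^{-n}\psi_{2n}=0\Big\}. \] Then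 the operators $A_t$, $t\in\mathbb{R}\cup\{\infty\}$, are exactly all the self-adjoint extensions of $A$: each $A_t$ is a self-adjoint extension of $A$, and every self-adjoint operator in $\ell^2(\mathbb{Z})$ extending $A$ equals $A_t$ for some $t\in\mathbb{R}\cup\{\infty\}$. -/

import Mathlib

namespace QJacobi

noncomputable section

/-- The complex Hilbert space of square summable sequences indexed by the integers. -/
abbrev ellTwo : Type := lp (fun _ : ℤ => ℂ) 2

/-- The `n`-th vector of the standard basis. -/
def e (n : ℤ) : ellTwo := lp.single 2 n 1

/-- The action of the doubly infinite Jacobi matrix on arbitrary sequences: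
the `n`-th entry of the image of `ψ` is `q ^ (-n + 1) ψ (n - 1) + q ^ (-n) ψ (n + 1)`. -/
def jacobi (q : ℝ) : (ℤ → ℂ) →ₗ[ℂ] (ℤ → ℂ) where
  toFun ψ n := (q : ℂ) ^ (-n + 1) * ψ (n - 1) + (q : ℂ) ^ (-n) * ψ (n + 1)
  map_add' ψ χ := by
    funext n
    simp only [Pi.add_apply]
    ring
  map_smul' c ψ := by
    funext n
    simp only [Pi.smul_apply, smul_eq_mul, RingHom.id_apply]
    ring

/-- The maximal operator: `ψ` belongs to its domain if and only if both `ψ` and its image under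
the Jacobi matrix are square summable. -/
def Amax (q : ℝ) : ellTwo →ₗ.[ℂ] ellTwo where
  domain :=
    { carrier := {ψ | Memℓp (jacobi q ψ) 2}
      zero_mem' := by
        simp only [Set.mem_ofPred_eq, lp.coeFn_zero, map_zero]
        exact zero_memℓp
      add_mem' := by
        intro ψ χ hψ hχ
        simp only [Set.mem_ofPred_eq, lp.coeFn_add, map_add] at *
        exact hψ.add hχ
      smul_mem' := by
        intro c ψ hψ
        simp only [Set.mem_ofPred_eq, lp.coeFn_smul, map_smul] at *
        exact hψ.const_smul c }
  toFun :=
    { toFun := fun ψ => ⟨jacobi q (ψ : ellTwo), ψ.2⟩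
      map_add' := by
        intro ψ χ
        exact lp.ext (map_add (jacobi q) ((ψ : ellTwo) : ℤ → ℂ) ((χ : ellTwo) : ℤ → ℂ))
      map_smul' := by
        intro c ψ
        exact lp.ext (map_smul (jacobi q) c ((ψ : ellTwo) : ℤ → ℂ)) }

theorem mem_Amax_domain {q : ℝ} {ψ : ellTwo} :
    ψ ∈ (Amax q).domain ↔ Memℓp (jacobi q ψ) 2 := Iff.rfl

theorem Amax_apply (q : ℝ) (ψ : (Amax q).domain) (n : ℤ) :
    (Amax q ψ : ellTwo) n = (q : ℂ) ^ (-n + 1) * (ψ : ellTwo) (n - 1)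
      + (q : ℂ) ^ (-n) * (ψ : ellTwo) (n + 1) := rfl

theorem jacobi_e (q : ℝ) (n : ℤ) :
    jacobi q (e n) =
      (((q : ℂ) ^ (-n + 1) • e (n - 1) + (q : ℂ) ^ (-n) • e (n + 1) : ellTwo) : ℤ → ℂ) := by
  funext m
  simp only [jacobi, e, LinearMap.coe_mk, AddHom.coe_mk, lp.coeFn_add, lp.coeFn_smul,
    Pi.add_apply, Pi.smul_apply, smul_eq_mul, lp.coeFn_single, Pi.single_apply]
  by_cases h1 : m = n - 1
  · subst h1
    rw [if_neg (by omega), if_pos (by omega), if_pos rfl, if_neg (by omega)]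
    simp [add_comm, sub_eq_add_neg]
  · by_cases h2 : m = n + 1
    · subst h2
      rw [if_pos (by omega), if_neg (by omega), if_neg (by omega), if_pos rfl]
      simp [add_comm]
    · rw [if_neg (by omega), if_neg (by omega), if_neg h1, if_neg h2]
      simp

theorem span_e_le (q : ℝ) : Submodule.span ℂ (Set.range e) ≤ (Amax q).domain := by
  rw [Submodule.span_le]
  rintro _ ⟨n, rfl⟩
  change Memℓp (jacobi q (e n)) 2
  rw [jacobi_e]
  exact lp.memℓp _

/-- The minimally defined operator `A`, with domain the linear span of the standard basis. -/
def A (q : ℝ) : ellTwo →ₗ.[ℂ] ellTwo where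
  domain := Submodule.span ℂ (Set.range e)
  toFun := (Amax q).toFun ∘ₗ Submodule.inclusion (span_e_le q)

/-- The defining formula `A eₙ = q ^ (-n + 1) eₙ₋₁ + q ^ (-n) eₙ₊₁`. -/
theorem A_e (q : ℝ) (n : ℤ) :
    A q ⟨e n, Submodule.subset_span ⟨n, rfl⟩⟩
      = (q : ℂ) ^ (-n + 1) • e (n - 1) + (q : ℂ) ^ (-n) • e (n + 1) :=
  lp.ext (jacobi_e q n)

/-- The boundary condition at `+∞` with parameter `t ∈ ℝ ∪ {∞}`. -/
def BoundaryCondition (q : ℝ) : OnePoint ℝ → (ℤ → ℂ) → Prop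
  | OnePoint.infty, ψ =>
      Filter.Tendsto (fun n : ℤ => (q : ℂ) ^ (-n) * ψ (2 * n)) Filter.atTop (nhds 0)
  | OnePoint.some t, ψ =>
      Filter.Tendsto (fun n : ℤ => (q : ℂ) ^ (-n) * (ψ (2 * n + 1) + (t : ℂ) * ψ (2 * n)))
        Filter.atTop (nhds 0) ∧
      Filter.Tendsto (fun n : ℤ => (q : ℂ) ^ (-n) * ((q : ℂ) * ψ (2 * n - 1) - (t : ℂ) * ψ (2 * n)))
        Filter.atTop (nhds 0)

theorem BoundaryCondition.zero (q : ℝ) (t : OnePoint ℝ) : BoundaryCondition q t 0 := by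
  induction t using OnePoint.rec <;> simp [BoundaryCondition]

theorem BoundaryCondition.add {q : ℝ} {t : OnePoint ℝ} {ψ χ : ℤ → ℂ}
    (hψ : BoundaryCondition q t ψ) (hχ : BoundaryCondition q t χ) :
    BoundaryCondition q t (ψ + χ) := by
  induction t using OnePoint.rec with
  | infty =>
    have h := Filter.Tendsto.add hψ hχ
    rw [add_zero] at h
    refine h.congr fun n => ?_
    simp only [Pi.add_apply]
    ring
  | coe t =>
    have h₁ := Filter.Tendsto.add hψ.1 hχ.1
    have h₂ := Filter.Tendsto.add hψ.2 hχ.2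
    rw [add_zero] at h₁ h₂
    refine ⟨h₁.congr fun n => ?_, h₂.congr fun n => ?_⟩ <;>
    · simp only [Pi.add_apply]
      ring

theorem BoundaryCondition.smul {q : ℝ} {t : OnePoint ℝ} (c : ℂ) {ψ : ℤ → ℂ}
    (hψ : BoundaryCondition q t ψ) : BoundaryCondition q t (c • ψ) := by
  induction t using OnePoint.rec with
  | infty =>
    have h := Filter.Tendsto.const_mul c hψ
    rw [mul_zero] at h
    refine h.congr fun n => ?_
    simp only [Pi.smul_apply, smul_eq_mul]
    ring
  | coe t =>
    have h₁ := Filter.Tendsto.const_mul c hψ.1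
    have h₂ := Filter.Tendsto.const_mul c hψ.2
    rw [mul_zero] at h₁ h₂
    refine ⟨h₁.congr fun n => ?_, h₂.congr fun n => ?_⟩ <;>
    · simp only [Pi.smul_apply, smul_eq_mul]
      ring

/-- The domain of `At q t`. -/
def AtDomain (q : ℝ) (t : OnePoint ℝ) : Submodule ℂ ellTwo where
  carrier := {ψ | ψ ∈ (Amax q).domain ∧ BoundaryCondition q t ψ}
  zero_mem' := ⟨zero_mem _, BoundaryCondition.zero q t⟩
  add_mem' hψ hχ := ⟨add_mem hψ.1 hχ.1, hψ.2.add hχ.2⟩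
  smul_mem' c _ hψ := ⟨Submodule.smul_mem _ c hψ.1, hψ.2.smul c⟩

theorem AtDomain_le (q : ℝ) (t : OnePoint ℝ) : AtDomain q t ≤ (Amax q).domain :=
  fun _ hψ => hψ.1

/-- The restriction of the maximal operator to the sequences satisfying the boundary condition
with parameter `t`. -/
def At (q : ℝ) (t : OnePoint ℝ) : ellTwo →ₗ.[ℂ] ellTwo where
  domain := AtDomain q t
  toFun := (Amax q).toFun ∘ₗ Submodule.inclusion (AtDomain_le q t)

theorem At_le_Amax (q : ℝ) (t : OnePoint ℝ) : At q t ≤ Amax q := by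
  refine ⟨AtDomain_le q t, ?_⟩
  rintro ⟨x, hx⟩ ⟨y, hy⟩ h
  obtain rfl : x = y := h
  rfl

end

end QJacobi

namespace QJacobi

open Filter Topology ComplexConjugate

local notation "⟪" x ", " y "⟫" => inner ℂ x y

/-! Away from an error `q ^ n (Aψ) n`, the recurrence reads `ψ (n + 1) = -q ψ (n - 1)`, so each `ψ`
in the maximal domain has boundary values `v`, `u` at `+∞` along even and odd indices
(`exists_hasBoundaryValues`), and every pair in `ℂ²` occurs (`exists_domain_hasBoundaryValues`).
Summation by parts (`inner_Amax_sub`) turns the defect of symmetry into the form `conj u * v' - conj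
v * u'`; the end `-∞` contributes nothing. Hence the adjoint of an extension of `A` lying below
`Amax` is cut out by annihilation under this form, and self-adjoint extensions correspond to the
lines in `ℂ²` equal to their own annihilator: `u + t v = 0` with `t` real, or `v = 0`. -/

/-- `v` and `u` are the limits of the rescaled even and odd entries of `ψ` at `+∞`. -/
structure HasBoundaryValues (q : ℝ) (ψ : ℤ → ℂ) (v u : ℂ) : Prop where
  even : Tendsto (fun k : ℤ => (-q : ℂ) ^ (-k) * ψ (2 * k)) atTop (𝓝 v)
  odd : Tendsto (fun k : ℤ => (-q : ℂ) ^ (-k) * ψ (2 * k + 1)) atTop (𝓝 u)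

theorem inner_e_left (n : ℤ) (f : ellTwo) : ⟪e n, f⟫ = f n := by
  rw [e, lp.inner_single_left]
  simp

theorem dense_A_domain (q : ℝ) : Dense ((A q).domain : Set ellTwo) := by
  rw [A, Submodule.dense_iff_topologicalClosure_eq_top, Submodule.topologicalClosure_eq_top_iff,
    Submodule.eq_bot_iff]
  intro f hf
  ext n
  rw [← inner_e_left, (Submodule.mem_orthogonal _ _).1 hf _ (Submodule.subset_span ⟨n, rfl⟩)]
  rfl

theorem norm_coord_le (ψ : ellTwo) (n : ℤ) : ‖ψ n‖ ≤ ‖ψ‖ :=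
  lp.norm_apply_le_norm (by norm_num) ψ n

/-! ### Boundary values at `+∞` -/

theorem exists_tendsto_of_dist_le_geometric {q C : ℝ} (hq₁ : q < 1) {f : ℤ → ℂ}
    (hf : ∀ k : ℤ, ‖f (k + 1) - f k‖ ≤ C * q ^ k) : ∃ l, Tendsto f atTop (𝓝 l) := by
  have hc : CauchySeq fun k : ℕ => f k := by
    refine cauchySeq_of_le_geometric q C hq₁ fun k => ?_
    have := hf k
    rw [dist_comm, dist_eq_norm]
    exact_mod_cast this
  obtain ⟨l, hl⟩ := cauchySeq_tendsto_of_complete hc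
  refine ⟨l, ?_⟩
  rwa [← Nat.map_cast_int_atTop, tendsto_map'_iff]

section

variable {q : ℝ}

/-- Consecutive rescaled entries differ by one entry of `Amax q ψ` times a factor of order `q ^ k`,
and the entries are bounded by the norm. -/
theorem exists_hasBoundaryValues (hq₀ : 0 < q) (hq₁ : q < 1) (ψ : (Amax q).domain) :
    ∃ v u, HasBoundaryValues q (ψ : ellTwo) v u := by
  have hq : (q : ℂ) ≠ 0 := by exact_mod_cast hq₀.ne'
  have hq' : (-q : ℂ) ≠ 0 := neg_ne_zero.2 hq
  have hneg (k : ℤ) : ‖(-q : ℂ) ^ k‖ = q ^ k := by simp [abs_of_pos hq₀]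
  have hodd : ∃ u, Tendsto (fun k : ℤ => (-q : ℂ) ^ (-k) * (ψ : ellTwo) (2 * k + 1)) atTop
      (𝓝 u) := by
    refine exists_tendsto_of_dist_le_geometric (C := q * ‖Amax q ψ‖) hq₁ fun k => ?_
    have key : (-q : ℂ) ^ (-(k + 1)) * (ψ : ellTwo) (2 * (k + 1) + 1)
        - (-q : ℂ) ^ (-k) * (ψ : ellTwo) (2 * k + 1)
        = (-q : ℂ) ^ (-(k + 1)) * (q : ℂ) ^ (2 * (k + 1)) * (Amax q ψ : ellTwo) (2 * (k + 1)) := by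
      rw [Amax_apply, show 2 * (k + 1) - 1 = 2 * k + 1 by ring, neg_add, zpow_add₀ hq',
        zpow_add₀ hq (-(2 * (k + 1))), zpow_neg (q : ℂ) (2 * (k + 1))]
      field_simp
      simp
      ring
    rw [key, norm_mul, norm_mul, hneg, norm_zpow, Complex.norm_real, Real.norm_of_nonneg hq₀.le,
      ← zpow_add₀ hq₀.ne', show -(k + 1) + 2 * (k + 1) = k + 1 by ring, zpow_add_one₀ hq₀.ne']
    have := norm_coord_le (Amax q ψ) (2 * (k + 1))
    have hp : 0 < q ^ k := by positivity
    calc q ^ k * q * ‖(Amax q ψ : ellTwo) (2 * (k + 1))‖ ≤ q ^ k * q * ‖Amax q ψ‖ := by gcongr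
      _ = _ := by ring
  have heven : ∃ v, Tendsto (fun k : ℤ => (-q : ℂ) ^ (-k) * (ψ : ellTwo) (2 * k)) atTop (𝓝 v) := by
    refine exists_tendsto_of_dist_le_geometric (C := ‖Amax q ψ‖) hq₁ fun k => ?_
    have key : (-q : ℂ) ^ (-(k + 1)) * (ψ : ellTwo) (2 * (k + 1))
        - (-q : ℂ) ^ (-k) * (ψ : ellTwo) (2 * k)
        = (-q : ℂ) ^ (-(k + 1)) * (q : ℂ) ^ (2 * k + 1) * (Amax q ψ : ellTwo) (2 * k + 1) := by
      rw [Amax_apply, show 2 * k + 1 - 1 = 2 * k by ring, show 2 * k + 1 + 1 = 2 * (k + 1) by ring,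
        neg_add, zpow_add₀ hq',
        zpow_add₀ hq (-(2 * k + 1)), zpow_neg (q : ℂ) (2 * k + 1)]
      field_simp
      simp
      ring
    rw [key, norm_mul, norm_mul, hneg, norm_zpow, Complex.norm_real, Real.norm_of_nonneg hq₀.le,
      ← zpow_add₀ hq₀.ne', show -(k + 1) + (2 * k + 1) = k by ring]
    have := norm_coord_le (Amax q ψ) (2 * k + 1)
    have hp : 0 < q ^ k := by positivity
    rw [mul_comm]
    gcongr
  obtain ⟨u, hu⟩ := hodd
  obtain ⟨v, hv⟩ := heven
  exact ⟨v, u, hv, hu⟩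

/-! ### Green's formula -/

/-- The discrete Wronskian of two sequences. -/
noncomputable def wronskian (q : ℝ) (ψ χ : ℤ → ℂ) (n : ℤ) : ℂ :=
  (q : ℂ) ^ (-n) * (conj (ψ (n + 1)) * χ n - conj (ψ n) * χ (n + 1))

/-- Entries are bounded, while the weight `q ^ (-n)` decays as `n → -∞`. -/
theorem tendsto_wronskian_neg (hq₀ : 0 < q) (hq₁ : q < 1) (ψ χ : ellTwo) :
    Tendsto (fun k : ℕ => wronskian q ψ χ (-(2 * k + 1 : ℤ) - 1)) atTop (𝓝 0) := by
  have hlim : Tendsto (fun k : ℕ => (q ^ 2) * (q ^ 2) ^ k * (2 * ‖ψ‖ * ‖χ‖)) atTop (𝓝 0) := by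
    have := (tendsto_pow_atTop_nhds_zero_of_lt_one (sq_nonneg q)
      (by nlinarith : q ^ 2 < 1)).const_mul (q ^ 2) |>.mul_const (2 * ‖ψ‖ * ‖χ‖)
    simpa using this
  refine squeeze_zero_norm (fun k => ?_) hlim
  rw [wronskian, norm_mul, norm_zpow, Complex.norm_real, Real.norm_of_nonneg hq₀.le]
  have h1 : q ^ (-(-(2 * k + 1 : ℤ) - 1)) = q ^ 2 * (q ^ 2) ^ k := by
    rw [show -(-(2 * k + 1 : ℤ) - 1) = ((2 + 2 * k : ℕ) : ℤ) by push_cast; ring, zpow_natCast,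
      pow_add, pow_mul]
  rw [h1]
  gcongr
  refine (norm_sub_le _ _).trans ?_
  rw [norm_mul, norm_mul, RCLike.norm_conj, RCLike.norm_conj]
  have h2 (m n : ℤ) : ‖ψ m‖ * ‖χ n‖ ≤ ‖ψ‖ * ‖χ‖ :=
    mul_le_mul (norm_coord_le _ _) (norm_coord_le _ _) (norm_nonneg _) (norm_nonneg _)
  linarith [h2 (-(2 * k + 1 : ℤ) - 1 + 1) (-(2 * k + 1 : ℤ) - 1),
    h2 (-(2 * k + 1 : ℤ) - 1) (-(2 * k + 1 : ℤ) - 1 + 1)]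

theorem tendsto_wronskian_even (hq₀ : 0 < q) {ψ χ : ℤ → ℂ} {v u v' u' : ℂ}
    (hψ : HasBoundaryValues q ψ v u) (hχ : HasBoundaryValues q χ v' u') :
    Tendsto (fun k : ℤ => wronskian q ψ χ (2 * k)) atTop (𝓝 (conj u * v' - conj v * u')) := by
  have hq : (q : ℂ) ≠ 0 := by exact_mod_cast hq₀.ne'
  have hc := Complex.continuous_conj.tendsto
  refine ((((hc u).comp hψ.odd).mul hχ.even).sub
    (((hc v).comp hψ.even).mul hχ.odd)).congr fun k => ?_
  -- The weight splits into one rescaling factor for each sequence; the signs cancel.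
  have h : (q : ℂ) ^ (-(2 * k)) = (-q : ℂ) ^ (-k) * (-q : ℂ) ^ (-k) := by
    rw [← mul_zpow, neg_mul_neg, mul_zpow, ← zpow_add₀ hq]
    ring_nf
  simp only [wronskian, Function.comp_apply, h, map_mul, map_zpow₀, map_neg, Complex.conj_ofReal]
  ring

theorem inner_Amax_sub (hq₀ : 0 < q) (hq₁ : q < 1) (ψ χ : (Amax q).domain) {v u v' u' : ℂ}
    (hψ : HasBoundaryValues q (ψ : ellTwo) v u) (hχ : HasBoundaryValues q (χ : ellTwo) v' u') :
    ⟪Amax q ψ, (χ : ellTwo)⟫ - ⟪(ψ : ellTwo), Amax q χ⟫ = conj u * v' - conj v * u' := by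
  have hs := (lp.hasSum_inner (𝕜 := ℂ) (Amax q ψ) χ).sub
    (lp.hasSum_inner (𝕜 := ℂ) (ψ : ellTwo) (Amax q χ))
  have hterm (n : ℤ) : ⟪(Amax q ψ : ellTwo) n, (χ : ellTwo) n⟫
        - ⟪(ψ : ellTwo) n, (Amax q χ : ellTwo) n⟫
      = (fun n => -wronskian q (ψ : ellTwo) (χ : ellTwo) (n - 1)) n
        - (fun n => -wronskian q (ψ : ellTwo) (χ : ellTwo) (n - 1)) (n + 1) := by
    simp only [RCLike.inner_apply, Amax_apply, wronskian, map_add, map_mul, map_zpow₀,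
      Complex.conj_ofReal, sub_add_cancel, add_sub_cancel_right,
      show -(n - 1) = -n + 1 by ring]
    ring
  simp only [hterm] at hs
  -- Odd cut-offs `N = 2k + 1` make the upper term of the telescoped sum the Wronskian at the even
  -- index `N - 1 = 2k`.
  have h2 : Tendsto (fun k : ℕ => 2 * k + 1) atTop atTop :=
    tendsto_atTop_mono (fun k => show k ≤ 2 * k + 1 by lia) tendsto_id
  have h1 := (hs.comp (Finset.tendsto_Ico_neg (R := ℤ))).comp h2
  refine tendsto_nhds_unique h1 ?_
  have h3 := ((tendsto_wronskian_even hq₀ hψ hχ).comp tendsto_natCast_atTop_atTop).sub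
    (tendsto_wronskian_neg hq₀ hq₁ ψ χ)
  rw [sub_zero] at h3
  refine h3.congr fun k => ?_
  simp only [Function.comp_apply]
  rw [Finset.sum_Ico_int_sub]
  push_cast
  rw [add_sub_cancel_right]
  ring

/-! ### Adjoints of extensions of `A` -/

theorem adjoint_le_Amax {T : ellTwo →ₗ.[ℂ] ellTwo} (hT : A q ≤ T) : T.adjoint ≤ Amax q := by
  have hd : Dense (T.domain : Set ellTwo) := (dense_A_domain q).mono hT.1
  have key (y : T.adjoint.domain) : ((T.adjoint y : ellTwo) : ℤ → ℂ) = jacobi q (y : ellTwo) := by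
    funext n
    have hmem : e n ∈ (A q).domain := Submodule.subset_span ⟨n, rfl⟩
    have h := (LinearPMap.adjoint_isFormalAdjoint hd).symm ⟨e n, hT.1 hmem⟩ y
    rw [← hT.2 (x := ⟨e n, hmem⟩) rfl, A_e, inner_add_left, inner_smul_left, inner_smul_left,
      inner_e_left, inner_e_left] at h
    simp only [inner_e_left] at h
    rw [← h]
    simp [jacobi]
  refine ⟨fun y hy => ?_, fun y z hyz => ?_⟩
  · rw [mem_Amax_domain, ← key ⟨y, hy⟩]
    exact lp.memℓp _
  · refine lp.ext ?_
    rw [key, hyz]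
    rfl

theorem mem_adjoint_domain_iff_of_le {T : ellTwo →ₗ.[ℂ] ellTwo} (hT : A q ≤ T) (hT' : T ≤ Amax q)
    (ψ : (Amax q).domain) : (ψ : ellTwo) ∈ T.adjoint.domain ↔
      ∀ χ : (Amax q).domain, (χ : ellTwo) ∈ T.domain →
        ⟪Amax q ψ, (χ : ellTwo)⟫ - ⟪(ψ : ellTwo), Amax q χ⟫ = 0 := by
  have hd : Dense (T.domain : Set ellTwo) := (dense_A_domain q).mono hT.1
  constructor
  · intro h χ hχ
    rw [sub_eq_zero, ← (adjoint_le_Amax hT).2 (x := ⟨ψ, h⟩) rfl, ← hT'.2 (x := ⟨χ, hχ⟩) rfl]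
    exact LinearPMap.adjoint_isFormalAdjoint hd ⟨ψ, h⟩ ⟨χ, hχ⟩
  · intro h
    refine LinearPMap.mem_adjoint_domain_of_exists _ ⟨Amax q ψ, fun χ => ?_⟩
    rw [hT'.2 (x := χ) (y := ⟨χ, hT'.1 χ.2⟩) rfl]
    exact sub_eq_zero.1 (h ⟨χ, hT'.1 χ.2⟩ χ.2)

/-! ### Realising arbitrary boundary values -/

/-- The sequence with boundary values `v` and `u`, annihilated by the Jacobi matrix
away from the origin. -/
noncomputable def boundarySeq (q : ℝ) (v u : ℂ) (n : ℤ) : ℂ :=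
  if 0 ≤ n then (-q : ℂ) ^ (n / 2) * (if Even n then v else u) else 0

theorem boundarySeq_even (v u : ℂ) {k : ℤ} (hk : 0 ≤ k) :
    boundarySeq q v u (2 * k) = (-q : ℂ) ^ k * v := by
  rw [boundarySeq, if_pos (by lia), if_pos (by simp)]
  simp

theorem boundarySeq_odd (v u : ℂ) {k : ℤ} (hk : 0 ≤ k) :
    boundarySeq q v u (2 * k + 1) = (-q : ℂ) ^ k * u := by
  rw [boundarySeq, if_pos (by lia), if_neg (by simp)]
  congr 2
  lia

theorem boundarySeq_neg (v u : ℂ) {n : ℤ} (hn : n < 0) : boundarySeq q v u n = 0 :=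
  if_neg (by lia)

theorem memℓp_boundarySeq (hq₀ : 0 < q) (hq₁ : q < 1) (v u : ℂ) :
    Memℓp (boundarySeq q v u) 2 := by
  refine memℓp_gen ?_
  simp only [ENNReal.toReal_ofNat, Real.rpow_ofNat]
  refine Summable.of_nat_of_neg_add_one ?_ ?_
  · have hsum (c : ℂ) : Summable fun k : ℕ => ‖(-q : ℂ) ^ (k : ℤ) * c‖ ^ 2 := by
      refine ((summable_geometric_of_lt_one (sq_nonneg q)
        (by nlinarith : q ^ 2 < 1)).mul_right (‖c‖ ^ 2)).congr fun k => ?_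
      simp [mul_pow, ← pow_mul, mul_comm, abs_of_pos hq₀]
    refine (HasSum.even_add_odd ((hsum v).congr fun k => ?_).hasSum
      ((hsum u).congr fun k => ?_).hasSum).summable
    · rw [← boundarySeq_even v u (Int.natCast_nonneg k)]
      simp
    · rw [← boundarySeq_odd v u (Int.natCast_nonneg k)]
      simp
  · refine summable_zero.congr fun n => ?_
    rw [boundarySeq_neg _ _ (by lia)]
    simp

/-- The cut-off at `0` breaks the recurrence `ψ (n + 1) = -q ψ (n - 1)` only at `n = -1` and `n =
0`. -/
theorem jacobi_boundarySeq (hq₀ : 0 < q) (v u : ℂ) {n : ℤ} (hn : n < -1 ∨ 0 < n) :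
    jacobi q (boundarySeq q v u) n = 0 := by
  have hq : (q : ℂ) ≠ 0 := by exact_mod_cast hq₀.ne'
  have hq' : (-q : ℂ) ≠ 0 := neg_ne_zero.2 hq
  simp only [jacobi, LinearMap.coe_mk, AddHom.coe_mk]
  rcases hn with hn | hn
  · rw [boundarySeq_neg _ _ (by lia), boundarySeq_neg _ _ (by lia)]
    simp
  obtain ⟨k, rfl | rfl⟩ := Int.even_or_odd' n
  · rw [show 2 * k - 1 = 2 * (k - 1) + 1 by ring, boundarySeq_odd _ _ (by lia),
      boundarySeq_odd _ _ (by lia), zpow_add₀ hq, zpow_sub_one₀ hq']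
    field_simp
    ring
  · rw [show 2 * k + 1 - 1 = 2 * k by ring, show 2 * k + 1 + 1 = 2 * (k + 1) by ring,
      boundarySeq_even _ _ (by lia), boundarySeq_even _ _ (by lia), zpow_add₀ hq, zpow_add_one₀ hq']
    field_simp
    ring

theorem exists_domain_hasBoundaryValues (hq₀ : 0 < q) (hq₁ : q < 1) (v u : ℂ) :
    ∃ ψ : (Amax q).domain, HasBoundaryValues q (ψ : ellTwo) v u := by
  have hq' : (-q : ℂ) ≠ 0 := neg_ne_zero.2 (by exact_mod_cast hq₀.ne')
  refine ⟨⟨⟨boundarySeq q v u, memℓp_boundarySeq hq₀ hq₁ v u⟩, ?_⟩, ?_, ?_⟩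
  · have h0 : Memℓp (jacobi q (boundarySeq q v u)) 0 := by
      refine memℓp_zero ((Set.finite_Icc (-1) 0).subset fun n hn => ?_)
      by_contra h
      refine hn (jacobi_boundarySeq hq₀ v u ?_)
      rw [Set.mem_Icc] at h
      lia
    exact h0.of_exponent_ge (by simp)
  · refine tendsto_const_nhds.congr' ?_
    filter_upwards [eventually_ge_atTop 0] with k hk
    rw [boundarySeq_even _ _ hk, zpow_neg, inv_mul_cancel_left₀ (zpow_ne_zero _ hq')]
  · refine tendsto_const_nhds.congr' ?_
    filter_upwards [eventually_ge_atTop 0] with k hk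
    rw [boundarySeq_odd _ _ hk, zpow_neg, inv_mul_cancel_left₀ (zpow_ne_zero _ hq')]

/-! ### Boundary conditions as lines in `ℂ²` -/

/-- The linear condition on boundary values that is equivalent to the boundary condition. -/
def BoundaryRelation : OnePoint ℝ → ℂ → ℂ → Prop
  | OnePoint.infty, v, _ => v = 0
  | OnePoint.some t, v, u => u + t * v = 0

/-- Convergence to zero does not see the sign `(-1) ^ k` by which the two normalisations differ. -/
theorem tendsto_zpow_mul_iff (f : ℤ → ℂ) :
    Tendsto (fun k : ℤ => (q : ℂ) ^ (-k) * f k) atTop (𝓝 0) ↔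
      Tendsto (fun k : ℤ => (-q : ℂ) ^ (-k) * f k) atTop (𝓝 0) := by
  rw [tendsto_zero_iff_norm_tendsto_zero,
    tendsto_zero_iff_norm_tendsto_zero (f := fun k : ℤ => (-q : ℂ) ^ (-k) * f k)]
  simp

/-- For finite `t` the two rescaled limits are `u + t v` and its negative, so both conditions
express one equation. -/
theorem HasBoundaryValues.boundaryCondition_iff (hq₀ : 0 < q) {ψ : ℤ → ℂ} {v u : ℂ}
    (h : HasBoundaryValues q ψ v u) (t : OnePoint ℝ) :
    BoundaryCondition q t ψ ↔ BoundaryRelation t v u := by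
  induction t using OnePoint.rec with
  | infty =>
    refine (tendsto_zpow_mul_iff fun k => ψ (2 * k)).trans
      ⟨fun h' => tendsto_nhds_unique h.even h', fun h' => ?_⟩
    have h' : v = 0 := h'
    exact h' ▸ h.even
  | coe t =>
    have hq : (-q : ℂ) ≠ 0 := neg_ne_zero.2 (by exact_mod_cast hq₀.ne')
    have h₁ : Tendsto (fun k : ℤ => (-q : ℂ) ^ (-k) * (ψ (2 * k + 1) + (t : ℂ) * ψ (2 * k)))
        atTop (𝓝 (u + t * v)) :=
      (h.odd.add (h.even.const_mul (t : ℂ))).congr fun k => by ring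
    have h₂ : Tendsto
        (fun k : ℤ => (-q : ℂ) ^ (-k) * ((q : ℂ) * ψ (2 * k - 1) - (t : ℂ) * ψ (2 * k)))
        atTop (𝓝 (-(u + t * v))) := by
      have hs : Tendsto (fun k : ℤ => k - 1) atTop atTop :=
        tendsto_atTop_add_const_right _ (-1) tendsto_id
      rw [neg_add]
      refine ((h.odd.comp hs).neg.add (h.even.const_mul (t : ℂ)).neg).congr fun k => ?_
      simp only [Function.comp_apply]
      rw [show 2 * (k - 1) + 1 = 2 * k - 1 by ring, show -(k - 1) = -k + 1 by ring,
        zpow_add_one₀ hq]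
      ring
    refine (and_congr (tendsto_zpow_mul_iff fun k => ψ (2 * k + 1) + (t : ℂ) * ψ (2 * k))
      (tendsto_zpow_mul_iff fun k => (q : ℂ) * ψ (2 * k - 1) - (t : ℂ) * ψ (2 * k))).trans
      ⟨fun h' => tendsto_nhds_unique h₁ h'.1, fun h' => ?_⟩
    have h' : u + t * v = 0 := h'
    rw [h'] at h₁ h₂
    exact ⟨h₁, neg_zero (G := ℂ) ▸ h₂⟩

theorem hasBoundaryValues_e (n : ℤ) : HasBoundaryValues q (e n) 0 0 := by
  have h {m : ℤ} (hm : n < m) : (e n : ℤ → ℂ) m = 0 := by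
    rw [e, lp.single_apply_ne _ _ _ hm.ne']
  constructor
  all_goals
    refine tendsto_const_nhds.congr' ?_
    filter_upwards [eventually_gt_atTop n, eventually_ge_atTop 0] with k hk hk'
    rw [h (by lia), mul_zero]

theorem A_le_At (hq₀ : 0 < q) (t : OnePoint ℝ) : A q ≤ At q t := by
  refine ⟨Submodule.span_le.2 ?_, ?_⟩
  · rintro _ ⟨n, rfl⟩
    refine ⟨span_e_le q (Submodule.subset_span ⟨n, rfl⟩), ?_⟩
    rw [(hasBoundaryValues_e n).boundaryCondition_iff hq₀]
    induction t using OnePoint.rec <;> simp [BoundaryRelation]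
  · rintro ⟨x, hx⟩ ⟨y, hy⟩ h
    obtain rfl : x = y := h
    rfl

theorem mem_At_domain_iff (hq₀ : 0 < q) {ψ : (Amax q).domain} {v u : ℂ}
    (h : HasBoundaryValues q (ψ : ellTwo) v u) (t : OnePoint ℝ) :
    (ψ : ellTwo) ∈ (At q t).domain ↔ BoundaryRelation t v u := by
  rw [← h.boundaryCondition_iff hq₀]
  exact ⟨fun h => h.2, fun h => ⟨ψ.2, h⟩⟩

/-- Each line is its own annihilator, because `t` is real. For the converse it suffices to test on a
spanning vector: `(0, 1)` or `(1, -t)`. -/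
theorem boundaryRelation_iff (t : OnePoint ℝ) (v u : ℂ) : BoundaryRelation t v u ↔
    ∀ v' u', BoundaryRelation t v' u' → conj u * v' - conj v * u' = 0 := by
  induction t using OnePoint.rec with
  | infty =>
    simp only [BoundaryRelation]
    constructor
    · rintro rfl v' u' rfl
      simp
    · intro h
      simpa using h 0 1 rfl
  | coe t =>
    simp only [BoundaryRelation]
    constructor
    · intro h v' u' h'
      rw [eq_neg_of_add_eq_zero_left h, eq_neg_of_add_eq_zero_left h']
      simp
      ring
    · intro h
      have := congrArg conj (h 1 (-t) (by ring))
      simp at this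
      rw [← this]
      ring

/-! ### Self-adjointness and classification -/

theorem isSelfAdjoint_At (hq₀ : 0 < q) (hq₁ : q < 1) (t : OnePoint ℝ) :
    IsSelfAdjoint (At q t) := by
  rw [LinearPMap.isSelfAdjoint_def]
  have hA := A_le_At hq₀ t
  have hmem (ψ : (Amax q).domain) :
      (ψ : ellTwo) ∈ (At q t).adjoint.domain ↔ (ψ : ellTwo) ∈ (At q t).domain := by
    obtain ⟨v, u, hψ⟩ := exists_hasBoundaryValues hq₀ hq₁ ψ
    rw [mem_adjoint_domain_iff_of_le hA (At_le_Amax q t), mem_At_domain_iff hq₀ hψ,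
      boundaryRelation_iff]
    constructor
    · intro h v' u' h'
      obtain ⟨χ, hχ⟩ := exists_domain_hasBoundaryValues hq₀ hq₁ v' u'
      rw [← inner_Amax_sub hq₀ hq₁ ψ χ hψ hχ]
      exact h χ ((mem_At_domain_iff hq₀ hχ t).2 h')
    · intro h χ h'
      obtain ⟨v', u', hχ⟩ := exists_hasBoundaryValues hq₀ hq₁ χ
      rw [inner_Amax_sub hq₀ hq₁ ψ χ hψ hχ]
      exact h v' u' ((mem_At_domain_iff hq₀ hχ t).1 h')
  refine LinearPMap.ext (Submodule.ext fun ψ => ⟨fun h => ?_, fun h => ?_⟩) fun x h h' => ?_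
  · exact (hmem ⟨ψ, (adjoint_le_Amax hA).1 h⟩).1 h
  · exact (hmem ⟨ψ, (At_le_Amax q t).1 h⟩).2 h
  · rw [(adjoint_le_Amax hA).2 (x := ⟨x, h⟩) (y := ⟨x, (At_le_Amax q t).1 h'⟩) rfl]
    rfl

/-- A nonzero pair of boundary values on which the boundary form vanishes determines
a point of `ℝ ∪ {∞}`. -/
theorem exists_boundaryRelation {v u : ℂ} (h0 : v ≠ 0 ∨ u ≠ 0)
    (h : conj u * v - conj v * u = 0) :
    ∃ t : OnePoint ℝ, ∀ v' u', conj u * v' - conj v * u' = 0 → BoundaryRelation t v' u' := by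
  by_cases hv : v = 0
  · subst hv
    refine ⟨OnePoint.infty, fun v' u' h' => ?_⟩
    change v' = 0
    simpa [h0.resolve_left (by simp)] using h'
  · have hv' : conj v ≠ 0 := (map_ne_zero _).2 hv
    -- Vanishing of the form on `(v, u)` against itself says exactly that `u / v` is real.
    have hreal : conj (-(u / v)) = -(u / v) := by
      rw [map_neg, map_div₀, neg_inj, div_eq_div_iff hv' hv]
      linear_combination h
    obtain ⟨t, ht⟩ := Complex.conj_eq_iff_real.1 hreal
    refine ⟨OnePoint.some t, fun v' u' h' => ?_⟩
    change u' + t * v' = 0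
    rw [← ht, ← hreal, map_neg, map_div₀]
    field_simp
    linear_combination -h'

theorem exists_eq_At (hq₀ : 0 < q) (hq₁ : q < 1) {T : ellTwo →ₗ.[ℂ] ellTwo} (hA : A q ≤ T)
    (hT : IsSelfAdjoint T) : ∃ t, At q t = T := by
  have hT' : T.adjoint = T := LinearPMap.isSelfAdjoint_def.1 hT
  have hmax : T ≤ Amax q := hT' ▸ adjoint_le_Amax hA
  have hmem (ψ : (Amax q).domain) := mem_adjoint_domain_iff_of_le hA hmax ψ
  rw [hT'] at hmem
  obtain ⟨φ, hφT, v, u, hφ, h0⟩ : ∃ φ : (Amax q).domain, (φ : ellTwo) ∈ T.domain ∧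
      ∃ v u, HasBoundaryValues q (φ : ellTwo) v u ∧ (v ≠ 0 ∨ u ≠ 0) := by
    -- If all boundary values on `T` vanished, every vector of the maximal domain would lie in the
    -- domain of `T.adjoint = T`, including one with values `(1, 0)`.
    by_contra! hcon
    obtain ⟨ψ, hψ⟩ := exists_domain_hasBoundaryValues hq₀ hq₁ 1 0
    refine one_ne_zero (hcon ψ ((hmem ψ).2 fun χ hχ => ?_) 1 0 hψ).1
    obtain ⟨v', u', hχ'⟩ := exists_hasBoundaryValues hq₀ hq₁ χ
    rw [inner_Amax_sub hq₀ hq₁ ψ χ hψ hχ', (hcon χ hχ v' u' hχ').1, (hcon χ hχ v' u' hχ').2]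
    simp
  have hform (χ : (Amax q).domain) (hχT : (χ : ellTwo) ∈ T.domain) (v' u' : ℂ)
      (hχ : HasBoundaryValues q (χ : ellTwo) v' u') : conj u * v' - conj v * u' = 0 := by
    rw [← inner_Amax_sub hq₀ hq₁ φ χ hφ hχ]
    exact (hmem φ).1 hφT χ hχT
  obtain ⟨t, ht⟩ := exists_boundaryRelation h0 (hform φ hφT v u hφ)
  have hle : T.domain ≤ (At q t).domain := fun χ hχT => by
    obtain ⟨v', u', hχ⟩ := exists_hasBoundaryValues hq₀ hq₁ ⟨χ, hmax.1 hχT⟩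
    exact (mem_At_domain_iff hq₀ hχ t).2 (ht v' u' (hform _ hχT v' u' hχ))
  -- Taking adjoints reverses the inclusion `hle`, and both operators are self-adjoint.
  have hge : (At q t).domain ≤ T.domain := fun ψ hψ => by
    refine (hmem ⟨ψ, (At_le_Amax q t).1 hψ⟩).2 fun χ hχ => ?_
    have h := isSelfAdjoint_At hq₀ hq₁ t
    rw [LinearPMap.isSelfAdjoint_def] at h
    rw [← h] at hψ
    exact (mem_adjoint_domain_iff_of_le (A_le_At hq₀ t) (At_le_Amax q t)
      ⟨ψ, _⟩).1 hψ χ (hle hχ)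
  refine ⟨t, LinearPMap.ext (le_antisymm hge hle) fun x h h' => ?_⟩
  rw [hmax.2 (x := ⟨x, h'⟩) (y := ⟨x, (At_le_Amax q t).1 h⟩) rfl]
  rfl

end

end QJacobi

theorem mainTheorem7 (q : ℝ) (hq₀ : 0 < q) (hq₁ : q < 1) :
    {T : QJacobi.ellTwo →ₗ.[ℂ] QJacobi.ellTwo | QJacobi.A q ≤ T ∧ IsSelfAdjoint T}
      = Set.range (QJacobi.At q) := by
  ext T
  constructor
  · rintro ⟨hA, hT⟩
    exact QJacobi.exists_eq_At hq₀ hq₁ hA hT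
  · rintro ⟨t, rfl⟩
    exact ⟨QJacobi.A_le_At hq₀ t, QJacobi.isSelfAdjoint_At hq₀ hq₁ t⟩
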